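/- Let $\mathcal N$ be a countable set of names (typically infinite), and let $\mathbb P$ be the group of permutations $\pi$ of $\mathcal N$ that move only finitely many names. A \emph{nominal set} is a set $X$ with an action of $\mathbb P$ such that each $x\in X$ has a finite support, i.e. there is a finite $S\subseteq\mathcal N$ such that $\pi\cdot x=x$ for every $\pi\in\mathbb P$ that fixes every element of $S$; it is \emph{orbit-finite} if the set $\mathrm{orb}(X)$ of its orbits is finite. A \emph{nominal deterministic Muller automaton} consists of an orbit-finite nominal set $Q$ of states, an initial state $q_0\in Q$, a transition function $\delta\colon Q\times\mathcal N\to Q$ with $\delta(\pi\cdot q,\pi(a))=\pi\cdot\delta(q,a)$ for all $\pi\in\mathbb P$, $q\in Q$, $a\in\mathcal N$, and a set $\mathcal A\subseteq\mathcal P(\mathrm{orb}(Q))$. The run of an infinite word $\alpha=\alpha_0\alpha_1\cdots\in\mathcal N^\omega$ is the sequence of states $r_0=q_0$, $r_{i+1}=\delta(r_i,\alpha_i)$, and $\alpha$ is accepted if the set of those orbits that contain $r_i$ for infinitely many $i$ is an element of $\mathcal A$. A language $\mathcal L\subseteq\mathcal N^\omega$ is \emph{nominal $\omega$-regular} if it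 is the set of words accepted by some nominal deterministic Muller automaton. The \emph{ultimately periodic fragment} of $\mathcal L$ is $$UP(\mathcal L)=\{\alpha\in\mathcal L \mid \alpha=uv^\omega \text{ for some finite words } u,v \text{ over } \mathcal N,\ v \text{ non-empty}\}.$$ \textbf{Theorem.} Let $\mathcal L_1,\mathcal L_2\subseteq\mathcal N^\omega$ be nominal $\omega$-regular languages. If $UP(\mathcal L_1)=UP(\mathcal L_2)$, then $\mathcal L_1=\mathcal L_2$. -/

import Mathlib

/-- The group of finite-kernel permutations of the set of names `N`: the bijections `N → N`
that move only finitely many names. -/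
def FinPerm (N : Type*) : Subgroup (Equiv.Perm N) where
  carrier := {π | {a | π a ≠ a}.Finite}
  one_mem' := by simp
  mul_mem' := by
    intro π ρ hπ hρ
    refine (hπ.union hρ).subset ?_
    intro a ha
    by_contra hc
    simp only [Set.mem_union, Set.mem_ofPred_eq, not_or, not_not] at hc
    exact ha (by rw [Equiv.Perm.mul_apply, hc.2, hc.1])
  inv_mem' := by
    intro π hπ
    refine Set.Finite.subset hπ ?_
    intro a ha hc
    exact ha (Equiv.Perm.inv_eq_iff_eq.mpr hc.symm)

/-- A set with an action of the finite-kernel permutations is nominal if each of its elements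
has a finite support. -/
class IsNominal (N X : Type*) [MulAction (FinPerm N) X] : Prop where
  finite_support : ∀ x : X, ∃ S : Finset N, MulAction.Supports (FinPerm N) (S : Set N) x

/-- The set of orbits of a set with an action of the finite-kernel permutations. -/
abbrev Orb (N X : Type*) [MulAction (FinPerm N) X] : Type _ :=
  MulAction.orbitRel.Quotient (FinPerm N) X

/-- A nominal deterministic Muller automaton over the names `N`. Since for each state and name
there is exactly one transition, the transition relation is given as a function `step`. -/
structure NDMA.{u, v} (N : Type u) where
  /-- the states -/
  Q : Type v
  [action : MulAction (FinPerm N) Q]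
  [nominal : IsNominal N Q]
  [orbitFinite : Finite (Orb N Q)]
  /-- the initial state -/
  init : Q
  /-- the transitions: `q` goes to `step q a` under the label `a` -/
  step : Q → N → Q
  step_equivariant : ∀ (π : FinPerm N) (q : Q) (a : N), step (π • q) (π • a) = π • step q a
  /-- the acceptance condition: a set of sets of orbits -/
  acc : Set (Set (Orb N Q))

attribute [instance] NDMA.action NDMA.nominal NDMA.orbitFinite

/-- The orbits that a sequence of elements traverses infinitely often. -/
def infOrbits (N : Type*) {X : Type*} [MulAction (FinPerm N) X] (r : ℕ → X) : Set (Orb N X) :=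
  {o | ∀ i, ∃ j, i < j ∧ r j ∈ o.orbit}

namespace NDMA

variable {N : Type*} (A : NDMA N)

/-- The unique run of the infinite word `α` from the state `q`. -/
def run (q : A.Q) (α : Stream' N) : ℕ → A.Q
  | 0 => q
  | i + 1 => A.step (run q α i) (α.get i)

/-- The infinite words accepted from the state `q`. -/
def languageFrom (q : A.Q) : Set (Stream' N) :=
  {α | infOrbits N (A.run q α) ∈ A.acc}

/-- The language of the automaton. -/
def language : Set (Stream' N) := A.languageFrom A.init

end NDMA

/-- A set of infinite words is nominal `ω`-regular if some nominal deterministic Muller automaton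
accepts exactly its words. The universe `v` is that of the set of states. -/
def IsNominalOmegaRegular.{u, v} {N : Type u} (L : Set (Stream' N)) : Prop :=
  ∃ A : NDMA.{u, v} N, A.language = L

/-- The ultimately periodic fragment: the words of `L` of the form `u v v v ⋯`, where `u` and `v`
are finite words and `v` is not empty. -/
def UP {N : Type*} (L : Set (Stream' N)) : Set (Stream' N) :=
  {α | α ∈ L ∧ ∃ (u v : List N) (hv : v ≠ []), α = u ++ₛ Stream'.cycle v hv}

universe u v₁ v₂

/-!
Every infinite word `α` can be replaced by an ultimately periodic word `β` which two given automata
cannot tell from `α`: in each of them the runs over `α` and over `β` traverse the same orbits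
infinitely often (`NDMA.exists_ultimatelyPeriodic_infOrbits_eq`). Hence two nominal `ω`-regular
languages that differ at `α` also differ at the ultimately periodic word `β`.

To find `β`, run both automata in parallel. A product of two orbit-finite nominal sets is
orbit-finite (`finite_orb_prod`), because up to the action a pair is determined by finitely many
coincidences between the supports of its components. So some orbit of pairs is met infinitely
often, and there are times `m < n` and a single permutation `π` that carries both states at time
`m` to the states at time `n`. The times can be chosen so late, and so far apart, that in both runs
the orbits met from `m` to `n` are precisely those met infinitely often. With `v` the part of `α`
between `m` and `n`, reading `v`, `π • v`, `π² • v`, … after time `m` shifts the run by `π` at each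
block (`NDMA.run_pumped`), so the orbits that are traversed stay the same. As `π` moves only
finitely many names, it has finite order (`FinPerm.isOfFinOrder`), and this word is ultimately
periodic.
-/

open MulAction

/-! ### Permutations that move finitely many names -/

/-- A permutation with finitely many moved names lives on the finite set of these names. -/
theorem FinPerm.isOfFinOrder {N : Type*} (π : FinPerm N) : IsOfFinOrder π := by
  classical
  have hfin : Finite {a // (π : Equiv.Perm N) a ≠ a} := π.2
  rw [← (FinPerm N).subtype_injective.isOfFinOrder_iff, Subgroup.subtype_apply]
  have hmem : ∀ a, (π : Equiv.Perm N) ((π : Equiv.Perm N) a) ≠ (π : Equiv.Perm N) a ↔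
      (π : Equiv.Perm N) a ≠ a := fun a => by simp
  have h := MonoidHom.isOfFinOrder
    (Equiv.Perm.ofSubtype (p := fun a => (π : Equiv.Perm N) a ≠ a))
    (isOfFinOrder_of_finite ((π : Equiv.Perm N).subtypePerm hmem))
  rwa [Equiv.Perm.ofSubtype_subtypePerm _ (fun _ h => h)] at h

/-- An injection of a finite set of names extends to a permutation of finitely many names. -/
theorem FinPerm.exists_extend {N : Type*} (D : Finset N) (f : N → N) (hf : Set.InjOn f D) :
    ∃ σ : FinPerm N, ∀ a ∈ D, σ • a = f a := by
  classical
  let F : Finset N := D ∪ D.image f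
  obtain ⟨g, hg⟩ := Finset.exists_equiv_extend_of_card_eq (α := F) (t := F) (by simp)
    (s := Finset.univ.filter (fun x : F => (x : N) ∈ D)) (f := fun x => f x)
    (by
      intro b hb
      simp only [Finset.mem_image, Finset.mem_filter, Finset.mem_univ, true_and] at hb
      obtain ⟨x, hx, rfl⟩ := hb
      exact Finset.mem_union_right _ (Finset.mem_image_of_mem f hx))
    (by
      intro x hx y hy h
      simp only [Finset.coe_filter, Finset.mem_univ, true_and, Set.mem_ofPred_eq] at hx hy
      exact Subtype.ext (hf hx hy h))
  refine ⟨⟨Equiv.Perm.ofSubtype (p := (· ∈ F)) g, ?_⟩, ?_⟩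
  · refine F.finite_toSet.subset fun a ha => ?_
    by_contra hc
    exact ha (Equiv.Perm.ofSubtype_apply_of_not_mem g hc)
  · intro a ha
    have haF : a ∈ F := Finset.mem_union_left _ ha
    change Equiv.Perm.ofSubtype (p := (· ∈ F)) g a = f a
    rw [Equiv.Perm.ofSubtype_apply_of_mem (p := (· ∈ F)) g haF]
    exact hg ⟨a, haF⟩ (by simpa using ha)

/-- The double coset of `ρ` with respect to the pointwise stabilisers of `S` and `T` depends only
on which points of `T` are carried by `ρ` to which points of `S`. -/
theorem FinPerm.exists_fixing_mul_eqOn {N : Type*} (S T : Finset N) (ρ ρ' : FinPerm N)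
    (h : ∀ s ∈ S, ∀ t ∈ T, ρ • t = s ↔ ρ' • t = s) :
    ∃ σ : FinPerm N, (∀ s ∈ S, σ • s = s) ∧ ∀ t ∈ T, (σ * ρ) • t = ρ' • t := by
  classical
  let f : N → N := fun a => if a ∈ S then a else ρ' • ρ⁻¹ • a
  have hfT : ∀ t ∈ T, f (ρ • t) = ρ' • t := by
    intro t ht
    by_cases hs : ρ • t ∈ S
    · simpa [f, hs] using ((h _ hs t ht).1 rfl).symm
    · simp [f, hs]
  have hinj : Set.InjOn f (S ∪ T.image (ρ • ·) : Finset N) := by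
    have key : ∀ s ∈ S, ∀ t ∈ T, f s = f (ρ • t) → s = ρ • t := by
      intro s hs t ht he
      rw [hfT t ht] at he
      simp only [f, hs, if_true] at he
      exact ((h s hs t ht).2 he.symm).symm
    intro a ha b hb hab
    simp only [Finset.coe_union, Finset.coe_image, Set.mem_union, Finset.mem_coe,
      Set.mem_image] at ha hb
    rcases ha with ha | ⟨t, ht, rfl⟩ <;> rcases hb with hb | ⟨t', ht', rfl⟩
    · simpa [f, ha, hb] using hab
    · exact key a ha t' ht' hab
    · exact (key b hb t ht hab.symm).symm
    · rw [hfT t ht, hfT t' ht'] at hab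
      rw [smul_left_cancel ρ' hab]
  obtain ⟨σ, hσ⟩ := FinPerm.exists_extend _ f hinj
  refine ⟨σ, fun s hs => ?_, fun t ht => ?_⟩
  · rw [hσ s (Finset.mem_union_left _ hs)]
    simp [f, hs]
  · rw [mul_smul, hσ _ (Finset.mem_union_right _ (Finset.mem_image_of_mem _ ht)), hfT t ht]

/-! ### Products of orbit-finite nominal sets -/

/-- Write a pair as `(σ • x, τ • y)` with `x` and `y` among finitely many representatives, whose
supports lie in finite sets `S` and `T`. Its orbit is determined by `x`, `y` and the finite relation
between `S` and `T` given by `σ⁻¹ * τ`. -/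
theorem finite_orb_prod {N X Y : Type*} [MulAction (FinPerm N) X] [MulAction (FinPerm N) Y]
    [IsNominal N X] [IsNominal N Y] [Finite (Orb N X)] [Finite (Orb N Y)] :
    Finite (Orb N (X × Y)) := by
  classical
  cases nonempty_fintype (Orb N X)
  cases nonempty_fintype (Orb N Y)
  choose SX hSX using IsNominal.finite_support (N := N) (X := X)
  choose SY hSY using IsNominal.finite_support (N := N) (X := Y)
  let S : Finset N := Finset.univ.biUnion fun o : Orb N X => SX o.out
  let T : Finset N := Finset.univ.biUnion fun o : Orb N Y => SY o.out
  have hS : ∀ (o : Orb N X) (π : FinPerm N), (∀ s ∈ S, π • s = s) → π • o.out = o.out :=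
    fun o π h => hSX o.out π fun s hs =>
      h s (Finset.mem_biUnion.2 ⟨o, Finset.mem_univ _, hs⟩)
  have hT : ∀ (o : Orb N Y) (π : FinPerm N), (∀ t ∈ T, π • t = t) → π • o.out = o.out :=
    fun o π h => hSY o.out π fun t ht =>
      h t (Finset.mem_biUnion.2 ⟨o, Finset.mem_univ _, ht⟩)
  have hX : ∀ x : X, ∃ σ : FinPerm N, σ • (Quotient.mk'' x : Orb N X).out = x := fun x =>
    orbitRel_apply.1 ((orbitRel (FinPerm N) X).symm (Quotient.mk_out (s := orbitRel (FinPerm N) X) x))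
  have hY : ∀ y : Y, ∃ τ : FinPerm N, τ • (Quotient.mk'' y : Orb N Y).out = y := fun y =>
    orbitRel_apply.1 ((orbitRel (FinPerm N) Y).symm (Quotient.mk_out (s := orbitRel (FinPerm N) Y) y))
  choose σ hσ using hX
  choose τ hτ using hY
  let code : X × Y → Orb N X × Orb N Y × Set (S × T) := fun z =>
    (Quotient.mk'' z.1, Quotient.mk'' z.2, {p | ((σ z.1)⁻¹ * τ z.2) • (p.2 : N) = p.1})
  refine Finite.of_injective (fun o : Orb N (X × Y) => code o.out) fun o o' h => ?_
  rw [← Quotient.out_eq o, ← Quotient.out_eq o']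
  change code o.out = code o'.out at h
  generalize o.out = z at h ⊢
  generalize o'.out = z' at h ⊢
  obtain ⟨x, y⟩ := z
  obtain ⟨x', y'⟩ := z'
  simp only [code, Prod.mk.injEq] at h
  obtain ⟨h1, h2, h3⟩ := h
  have h3' := fun (s) (hs : s ∈ S) (t) (ht : t ∈ T) => Set.ext_iff.1 h3 (⟨s, hs⟩, ⟨t, ht⟩)
  simp only [Set.mem_ofPred_eq] at h3'
  obtain ⟨κ, hκS, hκT⟩ := FinPerm.exists_fixing_mul_eqOn S T _ _ h3'
  -- `κ` fixes the representative of `x`, and `κ * ((σ x)⁻¹ * τ y)` acts on that of `y` as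
  -- `(σ x')⁻¹ * τ y'` does, so `σ x' * κ * (σ x)⁻¹` carries `(x, y)` to `(x', y')`
  have e1 : κ • (Quotient.mk'' x : Orb N X).out = (Quotient.mk'' x : Orb N X).out := hS _ _ hκS
  have e2 : (((σ x')⁻¹ * τ y')⁻¹ * (κ * ((σ x)⁻¹ * τ y))) • (Quotient.mk'' y : Orb N Y).out =
      (Quotient.mk'' y : Orb N Y).out := by
    refine hT _ _ fun t ht => ?_
    rw [mul_smul, hκT t ht, inv_smul_smul]
  refine Quotient.sound ((orbitRel (FinPerm N) (X × Y)).symm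
    (orbitRel_apply.2 ⟨σ x' * κ * (σ x)⁻¹, ?_⟩))
  refine Prod.ext ?_ ?_
  · change (σ x' * κ * (σ x)⁻¹) • x = x'
    rw [mul_smul, mul_smul, inv_smul_eq_iff.2 (hσ x).symm, e1, h1, hσ]
  · change (σ x' * κ * (σ x)⁻¹) • y = y'
    have e3 : σ x' * κ * (σ x)⁻¹ =
        τ y' * (((σ x')⁻¹ * τ y')⁻¹ * (κ * ((σ x)⁻¹ * τ y))) * (τ y)⁻¹ := by group
    rw [e3, mul_smul, mul_smul, inv_smul_eq_iff.2 (hτ y).symm, e2, h2, hτ]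

/-! ### Orbits traversed infinitely often -/

theorem mem_infOrbits_iff {N X : Type*} [MulAction (FinPerm N) X] {r : ℕ → X} {o : Orb N X} :
    o ∈ infOrbits N r ↔ ∀ i, ∃ j, i < j ∧ (Quotient.mk'' (r j) : Orb N X) = o := by
  simp only [infOrbits, Set.mem_ofPred_eq, orbitRel.Quotient.mem_orbit]

theorem exists_forall_ge_mk_mem_infOrbits {N X : Type*} [MulAction (FinPerm N) X]
    [Finite (Orb N X)] (r : ℕ → X) :
    ∃ M, ∀ j ≥ M, (Quotient.mk'' (r j) : Orb N X) ∈ infOrbits N r := by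
  have h : ∀ o : Orb N X, ∃ i, o ∉ infOrbits N r → ∀ j, i < j → Quotient.mk'' (r j) ≠ o := by
    intro o
    by_cases ho : o ∈ infOrbits N r
    · exact ⟨0, fun h => absurd ho h⟩
    · rw [mem_infOrbits_iff] at ho
      push Not at ho
      obtain ⟨i, hi⟩ := ho
      exact ⟨i, fun _ => hi⟩
  choose b hb using h
  obtain ⟨M, hM⟩ := (Set.finite_range b).bddAbove
  refine ⟨M + 1, fun j hj => ?_⟩
  by_contra hc
  have hle := hM ⟨(Quotient.mk'' (r j) : Orb N X), rfl⟩
  exact hb _ hc j (by omega) rfl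

theorem exists_bound_visits {N X : Type*} [MulAction (FinPerm N) X]
    [Finite (Orb N X)] (r : ℕ → X) (m : ℕ) :
    ∃ K, ∀ o ∈ infOrbits N r, ∃ j, m ≤ j ∧ j < K ∧ (Quotient.mk'' (r j) : Orb N X) = o := by
  have h : ∀ o : Orb N X, ∃ j, o ∈ infOrbits N r → m ≤ j ∧ Quotient.mk'' (r j) = o := by
    intro o
    by_cases ho : o ∈ infOrbits N r
    · obtain ⟨j, hj, hjo⟩ := mem_infOrbits_iff.1 ho m
      exact ⟨j, fun _ => ⟨hj.le, hjo⟩⟩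
    · exact ⟨0, fun h => absurd h ho⟩
  choose b hb using h
  obtain ⟨K, hK⟩ := (Set.finite_range b).bddAbove
  exact ⟨K + 1, fun o ho => ⟨b o, (hb o ho).1, Nat.lt_succ_of_le (hK ⟨o, rfl⟩), (hb o ho).2⟩⟩

/-! ### Ultimately periodic words -/

theorem Stream'.eq_cycle_take {N : Type*} (s : Stream' N) {d : ℕ} (hd : 0 < d)
    (h : ∀ i, s.get (i + d) = s.get i) (hne : s.take d ≠ []) :
    s = Stream'.cycle (s.take d) hne := by
  have hlen : (s.take d).length = d := Stream'.length_take d s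
  have key : ∀ i, s.get i = (Stream'.cycle (s.take d) hne).get i := by
    intro i
    induction i using Nat.strong_induction_on with
    | _ i ih =>
      rw [Stream'.cycle_eq]
      by_cases hi : i < d
      · rw [Stream'.get_append_left i _ _ (by omega), Stream'.take_get]
      · obtain ⟨k, rfl⟩ : ∃ k, i = d + k := ⟨i - d, by omega⟩
        have e := Stream'.get_append_right k (s.take d) (Stream'.cycle (s.take d) hne)
        rw [hlen] at e
        rw [e, ← ih k (by omega), Nat.add_comm d k, h]
  exact Stream'.ext key

theorem Stream'.exists_eq_append_cycle {N : Type*} (s : Stream' N) (m : ℕ) {d : ℕ} (hd : 0 < d)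
    (h : ∀ i, s.get (m + (i + d)) = s.get (m + i)) :
    ∃ (u v : List N) (hv : v ≠ []), s = u ++ₛ Stream'.cycle v hv := by
  have hne : (s.drop m).take d ≠ [] := by
    rw [← List.length_pos_iff, Stream'.length_take]
    exact hd
  refine ⟨s.take m, (s.drop m).take d, hne, ?_⟩
  rw [← Stream'.eq_cycle_take (s.drop m) hd (fun i => by simpa [Stream'.get_drop] using h i) hne,
    Stream'.append_take_drop]

/-- The word that agrees with `α` up to position `m` and then consists of the translates by
`1, π, π², …` of the block of `α` of length `p` at position `m`. -/
def pumped {N : Type*} (α : Stream' N) (π : FinPerm N) (m p : ℕ) : Stream' N := fun i =>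
  if i < m then α.get i else π ^ ((i - m) / p) • α.get (m + (i - m) % p)

theorem get_pumped_of_lt {N : Type*} (α : Stream' N) (π : FinPerm N) {m p i : ℕ} (h : i < m) :
    (pumped α π m p).get i = α.get i :=
  if_pos h

theorem get_pumped_add {N : Type*} (α : Stream' N) (π : FinPerm N) (m p i : ℕ) :
    (pumped α π m p).get (m + i) = π ^ (i / p) • α.get (m + i % p) := by
  change (if m + i < m then _ else _) = _
  rw [if_neg (by omega), Nat.add_sub_cancel_left]

theorem exists_pumped_eq_append_cycle {N : Type*} (α : Stream' N) (π : FinPerm N) (m : ℕ) {p : ℕ}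
    (hp : 0 < p) :
    ∃ (u v : List N) (hv : v ≠ []), pumped α π m p = u ++ₛ Stream'.cycle v hv := by
  refine Stream'.exists_eq_append_cycle _ m (d := p * orderOf π)
    (Nat.mul_pos hp (FinPerm.isOfFinOrder π).orderOf_pos) fun i => ?_
  rw [get_pumped_add, get_pumped_add, Nat.add_mul_div_left _ _ hp, Nat.add_mul_mod_self_left,
    pow_add, pow_orderOf_eq_one, mul_one]

/-! ### Runs over pumped words -/

namespace NDMA

variable {N : Type*} (A : NDMA N)

theorem run_pumped_of_le (q : A.Q) (α : Stream' N) (π : FinPerm N) {m p i : ℕ} (h : i ≤ m) :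
    A.run q (pumped α π m p) i = A.run q α i := by
  induction i with
  | zero => rfl
  | succ i ih =>
    rw [run, run, ih (by omega), get_pumped_of_lt _ _ (by omega)]

/-- If `π` carries the state at time `m` to the state at time `m + p`, then each further block of
the pumped word shifts the run by `π`. -/
theorem run_pumped (q : A.Q) (α : Stream' N) (π : FinPerm N) (m : ℕ) {p : ℕ} (hp : 0 < p)
    (hπ : π • A.run q α m = A.run q α (m + p)) (i : ℕ) :
    A.run q (pumped α π m p) (m + i) = π ^ (i / p) • A.run q α (m + i % p) := by
  induction i with
  | zero => simp [run_pumped_of_le]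
  | succ i ih =>
    have hlt := Nat.mod_lt i hp
    rw [← Nat.add_assoc, run, ih, get_pumped_add, step_equivariant]
    change π ^ (i / p) • A.run q α (m + i % p + 1) = _
    have hdm := Nat.div_add_mod i p
    rcases Nat.lt_or_ge (i % p + 1) p with hi | hi
    · obtain ⟨e1, e2⟩ := (Nat.div_mod_unique (a := i + 1) (c := i % p + 1) (d := i / p) hp).2
        ⟨by omega, hi⟩
      rw [e1, e2, Nat.add_assoc]
    · -- the end of a block, where the state at time `m + p` is traded for the one at time `m`
      have hi' : i + 1 = p * (i / p + 1) := by rw [Nat.mul_add]; omega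
      rw [Nat.add_assoc, show i % p + 1 = p by omega, ← hπ, hi', Nat.mul_mod_right,
        Nat.mul_div_cancel_left _ hp, pow_succ, mul_smul, Nat.add_zero]

/-- Pumping preserves the orbits traversed infinitely often, provided that from time `m` on
only these are met, and all of them before time `m + p`. -/
theorem infOrbits_run_pumped (q : A.Q) (α : Stream' N) (π : FinPerm N) (m : ℕ) {p : ℕ}
    (hp : 0 < p) (hπ : π • A.run q α m = A.run q α (m + p))
    (hlate : ∀ j ≥ m, (Quotient.mk'' (A.run q α j) : Orb N A.Q) ∈ infOrbits N (A.run q α))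
    (hall : ∀ o ∈ infOrbits N (A.run q α),
      ∃ j, m ≤ j ∧ j < m + p ∧ (Quotient.mk'' (A.run q α j) : Orb N A.Q) = o) :
    infOrbits N (A.run q (pumped α π m p)) = infOrbits N (A.run q α) := by
  have horb : ∀ i, (Quotient.mk'' (A.run q (pumped α π m p) (m + i)) : Orb N A.Q) =
      Quotient.mk'' (A.run q α (m + i % p)) := by
    intro i
    rw [A.run_pumped q α π m hp hπ]
    exact Quotient.sound (orbitRel_apply.2 (mem_orbit _ _))
  ext o
  constructor
  · intro ho
    obtain ⟨j, hj, rfl⟩ := mem_infOrbits_iff.1 ho m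
    obtain ⟨i, rfl⟩ := Nat.exists_eq_add_of_le hj.le
    rw [horb]
    exact hlate _ (Nat.le_add_right _ _)
  · intro ho
    obtain ⟨j, hj, hjp, hjo⟩ := hall o ho
    obtain ⟨i, rfl⟩ := Nat.exists_eq_add_of_le hj
    refine mem_infOrbits_iff.2 fun k => ⟨m + (i + p * (k + 1)), by nlinarith, ?_⟩
    rw [horb, Nat.add_mul_mod_self_left, Nat.mod_eq_of_lt (by omega), hjo]

/-! ### Reduction to ultimately periodic words -/

theorem exists_ultimatelyPeriodic_infOrbits_eq (B : NDMA N) (q : A.Q) (q' : B.Q) (α : Stream' N) :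
    ∃ β : Stream' N, (∃ (u v : List N) (hv : v ≠ []), β = u ++ₛ Stream'.cycle v hv) ∧
      infOrbits N (A.run q β) = infOrbits N (A.run q α) ∧
      infOrbits N (B.run q' β) = infOrbits N (B.run q' α) := by
  have : Finite (Orb N (A.Q × B.Q)) := finite_orb_prod
  let r : ℕ → A.Q × B.Q := fun i => (A.run q α i, B.run q' α i)
  obtain ⟨M, hM⟩ := exists_forall_ge_mk_mem_infOrbits (N := N) r
  obtain ⟨MA, hMA⟩ := exists_forall_ge_mk_mem_infOrbits (N := N) (A.run q α)
  obtain ⟨MB, hMB⟩ := exists_forall_ge_mk_mem_infOrbits (N := N) (B.run q' α)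
  let m := max M (max MA MB)
  obtain ⟨KA, hKA⟩ := exists_bound_visits (N := N) (A.run q α) m
  obtain ⟨KB, hKB⟩ := exists_bound_visits (N := N) (B.run q' α) m
  obtain ⟨n, hn, hnm⟩ := mem_infOrbits_iff.1 (hM m (by omega)) (max m (max KA KB))
  obtain ⟨π, hπ⟩ := orbitRel_apply.1 (Quotient.exact hnm)
  obtain ⟨p, rfl⟩ := Nat.exists_eq_add_of_le (show m ≤ n by omega)
  have hp : 0 < p := by omega
  refine ⟨pumped α π m p, exists_pumped_eq_append_cycle α π m hp, ?_, ?_⟩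
  · refine A.infOrbits_run_pumped q α π m hp (congrArg Prod.fst hπ)
      (fun j hj => hMA j (by omega)) fun o ho => ?_
    obtain ⟨j, h1, h2, h3⟩ := hKA o ho
    exact ⟨j, h1, by omega, h3⟩
  · refine B.infOrbits_run_pumped q' α π m hp (congrArg Prod.snd hπ)
      (fun j hj => hMB j (by omega)) fun o ho => ?_
    obtain ⟨j, h1, h2, h3⟩ := hKB o ho
    exact ⟨j, h1, by omega, h3⟩

end NDMA

theorem mainTheorem1 {N : Type u} [Countable N] (L₁ L₂ : Set (Stream' N))
    (h₁ : IsNominalOmegaRegular.{u, v₁} L₁) (h₂ : IsNominalOmegaRegular.{u, v₂} L₂)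
    (hUP : UP L₁ = UP L₂) : L₁ = L₂ := by
  obtain ⟨A, rfl⟩ := h₁
  obtain ⟨B, rfl⟩ := h₂
  ext α
  obtain ⟨β, hβ, hA, hB⟩ := A.exists_ultimatelyPeriodic_infOrbits_eq B A.init B.init α
  have hiff : β ∈ UP A.language ↔ β ∈ UP B.language := by rw [hUP]
  simp only [UP, Set.mem_ofPred_eq, hβ, and_true] at hiff
  change infOrbits N (A.run A.init α) ∈ A.acc ↔ infOrbits N (B.run B.init α) ∈ B.acc
  rw [← hA, ← hB]
  exact hiff
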